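/- Let $\Omega\subset\mathbb R^{n}$ be a bounded domain, let $A$ be a densely defined self-adjoint operator in the real space $L^2(\Omega)$ with $\langle Av,v\rangle\ge 0$ for $v\in D(A)$ and with compact resolvent, let $d\ge 0$, $r>0$, and let $C=C([-r,0];L^2(\Omega))$ with the sup norm $\|\cdot\|_C$. For $L\ge 0$ let $C\mathcal L_L\subset C$ be the set of functions that are Lipschitz with constant $L$. Let $B:L^2(\Omega)\to L^2(\Omega)$ be Lipschitz continuous, and let $\Theta^\ell,\Theta^u,\eta:C\to[0,r]$ satisfy: 1. $\Theta^\ell$ and $\Theta^u$ are continuous and $\Theta^\ell(\varphi)\le\Theta^u(\varphi)$ for all $\varphi\in C$; 2. $Z:=\{\varphi\in C:\Theta^\ell(\varphi)=0\}\subset C\mathcal L_L$ for some $L$; 3. $\eta$ is continuous, and whenever $\varphi,\psi\in C$ satisfy $\psi(\theta)=\varphi(\theta)$ for all $\theta\in[-\Theta^u(\varphi),-\Theta^\ell(\varphi)]$, then $\eta(\psi)=\eta(\varphi)$; 4. $\eta(\varphi)>0$ for all $\varphi\in Z$; 5. there are $\omega>0$ and $L_\eta>0$ such that $|\eta(\varphi)-\eta(\psi)|\le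 L_\eta\|\varphi-\psi\|_C$ for all $\varphi,\psi\in\{\chi\in C:\exists\,\nu\in Z,\ \|\chi-\nu\|_C\le\omega\}$. Write $u_t(\theta)=u(t+\theta)$, $\theta\in[-r,0]$, and $F(\varphi)=B(\varphi(-\eta(\varphi)))$. Let $S_t:C\to C$, $S_t\varphi=u_t$, $t\ge0$, be the evolution operator of $$\partial_t u+Au+du=F(u_t),\quad t>0,\qquad u|_{[-r,0]}=\varphi,$$ where $u\in C([-r,\infty);L^2(\Omega))$ is the mild solution, i.e. $u|_{[-r,0]}=\varphi$ and $$u(t)=e^{-At}\varphi(0)+\int_0^t e^{-A(t-s)}\{F(u_s)-d\,u(s)\}\,ds,\qquad t\ge0.$$ Let $\mathcal A\subset C$ be the compact global attractor of $(S_t,C)$, i.e. a nonempty compact set with $S_t\mathcal A=\mathcal A$ for all $t\ge0$ such that $\sup_{\varphi\in D}\operatorname{dist}_C(S_t\varphi,\mathcal A)\to0$ as $t\to\infty$ for every bounded $D\subset C$. Then there is a constant $\widetilde L\ge 0$ such that $\mathcal A\subset C\mathcal L_{\widetilde L}$. -/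

import Mathlib

open Set MeasureTheory
open scoped NNReal RealInnerProductSpace

noncomputable section

namespace DelayPDE

/-- The real Hilbert space `L²(Ω)`, `Ω ⊆ ℝⁿ`, with Lebesgue measure. -/
abbrev L2 {n : ℕ} (Ω : Set (EuclideanSpace ℝ (Fin n))) : Type :=
  Lp ℝ 2 (volume.restrict Ω)

section Operator

variable {H : Type*} [NormedAddCommGroup H] [InnerProductSpace ℝ H]

/-- `A` has a compact resolvent: for some real `c` the operator `A - c` maps `D(A)` bijectively
onto `H` and its inverse `R` is a compact bounded operator. -/
def HasCompactResolvent (A : H →ₗ.[ℝ] H) : Prop :=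
  ∃ (c : ℝ) (R : H →L[ℝ] H), IsCompactOperator R ∧
    (∀ x : A.domain, R (A x - c • (x : H)) = x) ∧
    (∀ y : H, ∃ x : A.domain, (x : H) = R y ∧ A x - c • (x : H) = y)

/-- The eigenspace `{x ∈ D(A) : A x = c x}` (which is `{0}` if `c` is not an eigenvalue). -/
def eigenspace (A : H →ₗ.[ℝ] H) (c : ℝ) : Submodule ℝ H where
  carrier := {x | ∃ y : A.domain, (y : H) = x ∧ A y = c • x}
  zero_mem' := ⟨0, by simp⟩
  add_mem' := by
    rintro _ _ ⟨x, rfl, hx⟩ ⟨y, rfl, hy⟩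
    exact ⟨x + y, by simp, by rw [A.map_add, hx, hy, smul_add]⟩
  smul_mem' := by
    rintro a _ ⟨x, rfl, hx⟩
    exact ⟨a • x, by simp, by rw [A.map_smul, hx, smul_comm]⟩

variable [CompleteSpace H]

/-- The semigroup `e^{-tA}`, `t ≥ 0`, of a nonnegative self-adjoint operator `A` with compact
resolvent (so `H` is the orthogonal sum of the eigenspaces of `A`), by its spectral resolution
`e^{-tA} x = ∑ c, e^{-c t} P_c x`, where `P_c` is the orthogonal projection onto the eigenspace
at `c`.  The eigenspaces of a self-adjoint operator are closed, so that the closure below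
changes nothing; it only makes the orthogonal projection available. -/
def semigroup (A : H →ₗ.[ℝ] H) (t : ℝ) (x : H) : H :=
  ∑' c : ℝ, Real.exp (-(c * t)) • (eigenspace A c).topologicalClosure.starProjection x

end Operator

/-- The phase space `C([-r, 0]; H)` with the sup norm. -/
abbrev Phase (r : ℝ) (H : Type*) [TopologicalSpace H] : Type _ := C(Icc (-r) (0 : ℝ), H)

section Equation

variable {H : Type*} [NormedAddCommGroup H] {r : ℝ}

/-- The map `s ↦ -s` from `[0, r]` to `[-r, 0]`. -/
def negPoint (s : Icc (0 : ℝ) r) : Icc (-r) (0 : ℝ) :=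
  ⟨-(s : ℝ), by have := s.2.2; linarith, by have := s.2.1; linarith⟩

/-- The delay term `F(φ) = B(φ(-η(φ)))`. -/
def delayTerm (B : H → H) (η : Phase r H → Icc (0 : ℝ) r) (φ : Phase r H) : H :=
  B (φ (negPoint (η φ)))

/-- The value `u(s)` of a continuous function `u : [-r, ∞) → H` at a real `s ≥ -r`
(for `s < -r`, which never matters below, it is `u(-r)`). -/
def valueAt (u : C(Ici (-r), H)) (s : ℝ) : H := u ⟨max (-r) s, mem_Ici.2 (le_max_left _ _)⟩

/-- The segment `u_t ∈ C([-r, 0]; H)`, `u_t(θ) = u(t + θ)`, for `t ≥ 0`. -/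
def segment (u : C(Ici (-r), H)) (t : ℝ) : Phase r H where
  toFun θ := valueAt u (t + θ)
  continuous_toFun := by
    unfold valueAt
    fun_prop

/-- `φ ∈ C𝓛_L`: the functions in `C([-r, 0]; H)` that are Lipschitz with constant `L`. -/
def lipschitzClass (r : ℝ) (H : Type*) [NormedAddCommGroup H] (L : ℝ≥0) : Set (Phase r H) :=
  {φ | LipschitzWith L φ}

/-- The set `Z` of the `φ` with `Θˡ(φ) = 0`. -/
def zeroSet (Θl : Phase r H → Icc (0 : ℝ) r) : Set (Phase r H) := {φ | (Θl φ : ℝ) = 0}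

/-- The neighbourhood `U_ω(Z)` of the points at distance at most `ω` from a point of `Z`. -/
def neighbourhood (Z : Set (Phase r H)) (ω : ℝ) : Set (Phase r H) :=
  {χ | ∃ ν ∈ Z, ‖χ - ν‖ ≤ ω}

/-- The delay `η` ignores the values of `φ` outside `[-Θᵘ(φ), -Θˡ(φ)]`. -/
def IgnoresOutside (Θu Θl η : Phase r H → Icc (0 : ℝ) r) : Prop :=
  ∀ φ ψ : Phase r H,
    (∀ θ : Icc (-r) (0 : ℝ), (θ : ℝ) ∈ Icc (-(Θu φ : ℝ)) (-(Θl φ : ℝ)) → ψ θ = φ θ) → η ψ = η φ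

variable [InnerProductSpace ℝ H] [CompleteSpace H]

/-- `u ∈ C([-r, ∞); H)` is a (global) mild solution of
`u'(t) + A u(t) + d u(t) = B(u(t - η(u_t)))`, `t > 0`, with `u = φ` on `[-r, 0]`. -/
def IsMildSolution (A : H →ₗ.[ℝ] H) (d : ℝ) (B : H → H) (η : Phase r H → Icc (0 : ℝ) r)
    (φ : Phase r H) (u : C(Ici (-r), H)) : Prop :=
  (∀ θ : Icc (-r) (0 : ℝ), valueAt u θ = φ θ) ∧
  ∀ t : ℝ, 0 ≤ t →
    valueAt u t = semigroup A t (valueAt u 0) +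
      ∫ s in (0 : ℝ)..t, semigroup A (t - s) (delayTerm B η (segment u s) - d • valueAt u s)

open Classical in
/-- The evolution operator `S_t φ = u_t`, where `u` is the mild solution with initial
function `φ` (the value is `0` if there is no mild solution). -/
def evolution (A : H →ₗ.[ℝ] H) (d : ℝ) (B : H → H) (η : Phase r H → Icc (0 : ℝ) r)
    (t : ℝ) (φ : Phase r H) : Phase r H :=
  if h : ∃ u : C(Ici (-r), H), IsMildSolution A d B η φ u then segment h.choose t else 0

end Equation

/-- `K` is the (compact) global attractor of `S`: it is nonempty and compact, strictly invariant,
`S_t K = K` for `t ≥ 0`, and attracts every bounded set uniformly. -/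
structure IsGlobalAttractor {X : Type*} [PseudoMetricSpace X] (S : ℝ → X → X) (K : Set X) :
    Prop where
  nonempty : K.Nonempty
  isCompact : IsCompact K
  invariant : ∀ t : ℝ, 0 ≤ t → S t '' K = K
  attracts : ∀ D : Set X, Bornology.IsBounded D →
    ∀ ε : ℝ, 0 < ε → ∃ T : ℝ, ∀ t : ℝ, T ≤ t → ∀ x ∈ D, ∃ y ∈ K, dist (S t x) y < ε

end DelayPDE

end

namespace DelayPDE

/-! ### Multiplier operators along an orthogonal family of subspaces. -/

section Diagonal

variable {ι H : Type*} [NormedAddCommGroup H] [InnerProductSpace ℝ H]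

/-! Each point of the attractor is `u_T`, with `T` as large as desired, for a solution whose
segments stay in the attractor and hence in a fixed ball (if no mild solution exists, the point is
`0`). It therefore suffices to bound the Lipschitz constant of a bounded mild solution after a fixed
time.

Smoothing by the semigroup makes `u` Hölder continuous with exponent 3/4 (`norm_mild_sub_le_rpow`).
The usual next step, from Hölder forcing to a Lipschitz solution, is blocked: the forcing contains
`B(u(s - η(u_s)))`, where the time change `s ↦ s - η(u_s)` is merely continuous. The substitute is a
bound that ignores time changes. If `P_c` is the projection onto the eigenspace at `c`, then `∫ c
e^{-c(a-s)} ds ≤ 1` over the past gives `c ‖P_c u(a)‖ ≤ ‖P_c u(a-1)‖ + sup_s ‖P_c f(s)‖`. So `A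
u(a)` is bounded as soon as `∑_c sup_s ‖P_c f(s)‖²` is finite (`norm_mild_sub_le_mul`).

Such sums of suprema are finite for every Hölder curve of exponent above 1/2, by chaining over finer
and finer grids and Bessel's inequality for each increment (`exists_sum_sup_le`). This applies to
`u` and `B ∘ u`, and a supremum over a time window does not increase when times in that window are
reparametrized. -/

theorem norm_sum_sq_of_isOrtho {V : ι → Submodule ℝ H} (hV : Pairwise fun i j => V i ⟂ V j)
    {y : ι → H} (hy : ∀ i, y i ∈ V i) (s : Finset ι) :
    ‖∑ i ∈ s, y i‖ ^ 2 = ∑ i ∈ s, ‖y i‖ ^ 2 :=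
  (OrthogonalFamily.of_pairwise hV).norm_sum (fun i => (⟨y i, hy i⟩ : V i)) s

theorem summable_of_isOrtho [CompleteSpace H] {V : ι → Submodule ℝ H}
    (hV : Pairwise fun i j => V i ⟂ V j) {y : ι → H} (hy : ∀ i, y i ∈ V i) {C : ℝ}
    (hC : ∀ s : Finset ι, ∑ i ∈ s, ‖y i‖ ^ 2 ≤ C) : Summable y :=
  ((OrthogonalFamily.of_pairwise hV).summable_iff_norm_sq_summable
    (fun i => (⟨y i, hy i⟩ : V i))).2
    (summable_of_sum_le (fun _ => sq_nonneg _) hC)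

theorem norm_tsum_sq_le_of_isOrtho [CompleteSpace H] {V : ι → Submodule ℝ H}
    (hV : Pairwise fun i j => V i ⟂ V j) {y : ι → H} (hy : ∀ i, y i ∈ V i) {C : ℝ}
    (hC : ∀ s : Finset ι, ∑ i ∈ s, ‖y i‖ ^ 2 ≤ C) : ‖∑' i, y i‖ ^ 2 ≤ C :=
  le_of_tendsto ((summable_of_isOrtho hV hy hC).hasSum.norm.pow 2)
    (Filter.Eventually.of_forall fun s => by
      rw [norm_sum_sq_of_isOrtho hV hy s]; exact hC s)

variable (V : ι → Submodule ℝ H) [∀ i, (V i).HasOrthogonalProjection]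

/-- Bessel's inequality for a family of mutually orthogonal subspaces. -/
theorem sum_norm_starProjection_sq_le (hV : Pairwise fun i j => V i ⟂ V j) (x : H)
    (s : Finset ι) : ∑ i ∈ s, ‖(V i).starProjection x‖ ^ 2 ≤ ‖x‖ ^ 2 := by
  have hmem : ∀ i, (V i).starProjection x ∈ V i := fun i =>
    (V i).starProjection_apply_mem x
  have h1 := norm_sum_sq_of_isOrtho hV hmem s
  set y := ∑ i ∈ s, (V i).starProjection x
  have h2 : ⟪x, y⟫ = ∑ i ∈ s, ‖(V i).starProjection x‖ ^ 2 := by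
    rw [inner_sum]
    refine Finset.sum_congr rfl fun i _ => ?_
    have := (V i).starProjection_inner_eq_zero x _ (hmem i)
    rw [inner_sub_left, sub_eq_zero] at this
    rw [this, real_inner_self_eq_norm_sq]
  have h3 := real_inner_le_norm x y
  rw [h2, ← h1] at h3
  rw [← h1]
  have h4 : ‖y‖ ≤ ‖x‖ := by
    rcases (norm_nonneg y).eq_or_lt with h | h
    · rw [← h]; exact norm_nonneg x
    · nlinarith
  gcongr

/-- The operator `x ↦ ∑ i, m i • P_i x`, where `P_i` is the orthogonal projection onto `V i`. -/
noncomputable def diagonal (m : ι → ℝ) (x : H) : H := ∑' i, m i • (V i).starProjection x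

variable {V}

theorem sum_norm_smul_starProjection_sq_le (hV : Pairwise fun i j => V i ⟂ V j) {m : ι → ℝ}
    {K : ℝ} (hm : ∀ i, |m i| ≤ K) (x : H) (s : Finset ι) :
    ∑ i ∈ s, ‖m i • (V i).starProjection x‖ ^ 2 ≤ (K * ‖x‖) ^ 2 := by
  calc ∑ i ∈ s, ‖m i • (V i).starProjection x‖ ^ 2
      ≤ ∑ i ∈ s, K ^ 2 * ‖(V i).starProjection x‖ ^ 2 := by
        refine Finset.sum_le_sum fun i _ => ?_
        rw [norm_smul, mul_pow, Real.norm_eq_abs]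
        gcongr
        exact hm i
    _ ≤ (K * ‖x‖) ^ 2 := by
        rw [← Finset.mul_sum, mul_pow]
        gcongr
        exact sum_norm_starProjection_sq_le V hV x s

theorem smul_starProjection_mem (m : ι → ℝ) (x : H) (i : ι) :
    m i • (V i).starProjection x ∈ V i :=
  (V i).smul_mem _ ((V i).starProjection_apply_mem x)

variable [CompleteSpace H]

theorem summable_diagonal (hV : Pairwise fun i j => V i ⟂ V j) {m : ι → ℝ}
    {K : ℝ} (hm : ∀ i, |m i| ≤ K) (x : H) : Summable fun i => m i • (V i).starProjection x :=
  summable_of_isOrtho hV (smul_starProjection_mem m x)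
    (sum_norm_smul_starProjection_sq_le hV hm x)

theorem norm_diagonal_sq_le (hV : Pairwise fun i j => V i ⟂ V j) {m : ι → ℝ} {x : H} {C : ℝ}
    (hC : ∀ s : Finset ι, ∑ i ∈ s, ‖m i • (V i).starProjection x‖ ^ 2 ≤ C) :
    ‖diagonal V m x‖ ^ 2 ≤ C :=
  norm_tsum_sq_le_of_isOrtho hV (smul_starProjection_mem m x) hC

theorem norm_diagonal_le (hV : Pairwise fun i j => V i ⟂ V j) {m : ι → ℝ} {K : ℝ} (hK : 0 ≤ K)
    (hm : ∀ i, |m i| ≤ K) (x : H) : ‖diagonal V m x‖ ≤ K * ‖x‖ :=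
  le_of_sq_le_sq (norm_diagonal_sq_le hV (sum_norm_smul_starProjection_sq_le hV hm x))
    (by positivity)

/-- `diagonal` with a bounded multiplier, as a bounded operator. -/
noncomputable def diagonalCLM (hV : Pairwise fun i j => V i ⟂ V j) {m : ι → ℝ} {K : ℝ}
    (hK : 0 ≤ K) (hm : ∀ i, |m i| ≤ K) : H →L[ℝ] H :=
  LinearMap.mkContinuous
    { toFun := diagonal V m
      map_add' := fun x y => by
        simp only [diagonal, map_add, smul_add]
        exact (summable_diagonal hV hm x).tsum_add (summable_diagonal hV hm y)
      map_smul' := fun a x => by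
        simp only [diagonal, map_smul, RingHom.id_apply]
        rw [← (summable_diagonal hV hm x).tsum_const_smul]
        exact tsum_congr fun i => smul_comm _ _ _ }
    K (norm_diagonal_le hV hK hm)

theorem diagonalCLM_apply (hV : Pairwise fun i j => V i ⟂ V j) {m : ι → ℝ} {K : ℝ}
    (hK : 0 ≤ K) (hm : ∀ i, |m i| ≤ K) (x : H) : diagonalCLM hV hK hm x = diagonal V m x := rfl

theorem diagonal_sub_left (hV : Pairwise fun i j => V i ⟂ V j) {m m' : ι → ℝ} {K K' : ℝ}
    (hm : ∀ i, |m i| ≤ K) (hm' : ∀ i, |m' i| ≤ K') (x : H) :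
    diagonal V m x - diagonal V m' x = diagonal V (m - m') x := by
  simp only [diagonal, Pi.sub_apply, sub_smul]
  exact ((summable_diagonal hV hm x).tsum_sub (summable_diagonal hV hm' x)).symm

theorem starProjection_diagonal (hV : Pairwise fun i j => V i ⟂ V j) {m : ι → ℝ} {K : ℝ}
    (hm : ∀ i, |m i| ≤ K) (x : H) (i : ι) :
    (V i).starProjection (diagonal V m x) = m i • (V i).starProjection x := by
  rw [diagonal, (V i).starProjection.map_tsum (summable_diagonal hV hm x), tsum_eq_single i]
  · exact (V i).starProjection_eq_self_iff.2 (smul_starProjection_mem m x i)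
  · intro j hj
    rw [Submodule.starProjection_apply_eq_zero_iff]
    exact (hV hj).le (smul_starProjection_mem m x j)

theorem diagonal_diagonal (hV : Pairwise fun i j => V i ⟂ V j) {m m' : ι → ℝ} {K : ℝ}
    (hm' : ∀ i, |m' i| ≤ K) (x : H) :
    diagonal V m (diagonal V m' x) = diagonal V (fun i => m i * m' i) x := by
  exact tsum_congr fun i => by rw [starProjection_diagonal hV hm', smul_smul]

/-- The operators need not be continuous in norm with respect to the parameter. With the vector
frozen at `f t₀`, dominated convergence applies to the squared components; the change of the vector
is absorbed by the uniform bound `K`. -/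
theorem continuous_diagonal {X : Type*} [TopologicalSpace X]
    (hV : Pairwise fun i j => V i ⟂ V j) {m : X → ι → ℝ} {K : ℝ} (hK : 0 ≤ K)
    (hm : ∀ t i, |m t i| ≤ K) (hmc : ∀ i, Continuous fun t => m t i) {f : X → H}
    (hf : Continuous f) : Continuous fun t => diagonal V (m t) (f t) := by
  rw [continuous_iff_continuousAt]
  intro t₀
  have hsq : Summable fun i => ‖(V i).starProjection (f t₀)‖ ^ 2 :=
    summable_of_sum_le (fun _ => sq_nonneg _) (sum_norm_starProjection_sq_le V hV (f t₀))
  have hbd : ∀ t i, |(m t - m t₀) i| ≤ K + K := fun t i =>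
    (abs_sub _ _).trans (add_le_add (hm t i) (hm t₀ i))
  have hle : ∀ t i, ‖(m t - m t₀) i • (V i).starProjection (f t₀)‖ ^ 2 ≤
      (K + K) ^ 2 * ‖(V i).starProjection (f t₀)‖ ^ 2 := by
    intro t i
    rw [norm_smul, mul_pow, Real.norm_eq_abs]
    gcongr
    exact hbd t i
  have hsum : ∀ t, Summable fun i => ‖(m t - m t₀) i • (V i).starProjection (f t₀)‖ ^ 2 :=
    fun t => Summable.of_nonneg_of_le (fun _ => sq_nonneg _) (hle t) (hsq.mul_left _)
  have hlim : Filter.Tendsto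
      (fun t => ∑' i, ‖(m t - m t₀) i • (V i).starProjection (f t₀)‖ ^ 2) (nhds t₀) (nhds 0) := by
    have := tendsto_tsum_of_dominated_convergence
      (f := fun t i => ‖(m t - m t₀) i • (V i).starProjection (f t₀)‖ ^ 2)
      (g := fun _ => (0 : ℝ)) (𝓕 := nhds t₀) (hsq.mul_left ((K + K) ^ 2))
      (fun i => by
        have : Continuous fun t => ‖(m t - m t₀) i • (V i).starProjection (f t₀)‖ ^ 2 := by
          have := hmc i
          simp only [Pi.sub_apply]
          fun_prop
        simpa using this.tendsto t₀)
      (Filter.Eventually.of_forall fun t i => by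
        rw [Real.norm_of_nonneg (sq_nonneg _)]; exact hle t i)
    simpa using this
  have hlim' : Filter.Tendsto (fun t => ‖diagonal V (m t - m t₀) (f t₀)‖) (nhds t₀) (nhds 0) := by
    have hs := (Real.continuous_sqrt.tendsto 0).comp hlim
    rw [Real.sqrt_zero] at hs
    refine squeeze_zero (fun _ => norm_nonneg _) (fun t => ?_) hs
    refine Real.le_sqrt_of_sq_le (norm_diagonal_sq_le hV fun s => ?_)
    exact (hsum t).sum_le_tsum s fun _ _ => sq_nonneg _
  rw [ContinuousAt, tendsto_iff_norm_sub_tendsto_zero]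
  have hf0 : Filter.Tendsto (fun t => K * ‖f t - f t₀‖) (nhds t₀) (nhds 0) := by
    have : Continuous fun t => K * ‖f t - f t₀‖ := by fun_prop
    simpa using this.tendsto t₀
  refine squeeze_zero (fun _ => norm_nonneg _) (fun t => ?_) (by simpa using hf0.add hlim')
  have h1 : diagonal V (m t) (f t) - diagonal V (m t₀) (f t₀) =
      diagonal V (m t) (f t - f t₀) + diagonal V (m t - m t₀) (f t₀) := by
    rw [← diagonal_sub_left hV (hm t) (hm t₀)]
    have := (diagonalCLM hV hK (hm t)).map_sub (f t) (f t₀)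
    simp only [diagonalCLM_apply] at this
    rw [this]
    abel
  rw [h1]
  exact (norm_add_le _ _).trans (add_le_add (norm_diagonal_le hV hK (hm t) _) le_rfl)

end Diagonal

/-! ### Chaining: square summable suprema of the components of a Hölder curve. -/

section Chaining

variable {ι H : Type*} [NormedAddCommGroup H] [InnerProductSpace ℝ H]

/-- The limit of a sequence, bounded by the weighted squares of its increments. -/
theorem norm_sq_le_of_chain {E : Type*} [NormedAddCommGroup E] {x : ℕ → E} {y : E}
    (hx : Filter.Tendsto x Filter.atTop (nhds y)) {e : ℕ → ℝ}
    (he : ∀ j, ‖x (j + 1) - x j‖ ^ 2 ≤ e j) (hs : Summable fun j => 2 ^ j * e j) :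
    ‖y‖ ^ 2 ≤ 2 * ‖x 0‖ ^ 2 + 4 * ∑' j, 2 ^ j * e j := by
  have he0 : ∀ j, 0 ≤ e j := fun j => (sq_nonneg _).trans (he j)
  refine le_of_tendsto (hx.norm.pow 2) (Filter.Eventually.of_forall fun n => ?_)
  have h1 : ‖x n - x 0‖ ≤ ∑ j ∈ Finset.range n, ‖x (j + 1) - x j‖ := by
    rw [← Finset.sum_range_sub]
    exact norm_sum_le _ _
  -- Cauchy–Schwarz with weights `2^{-j}` and `2^j`; the first factor sums to at most 2.
  have h2 : (∑ j ∈ Finset.range n, ‖x (j + 1) - x j‖) ^ 2 ≤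
      (∑ j ∈ Finset.range n, (1 / 2 : ℝ) ^ j) *
        ∑ j ∈ Finset.range n, 2 ^ j * ‖x (j + 1) - x j‖ ^ 2 := by
    refine Finset.sum_sq_le_sum_mul_sum_of_sq_le_mul _ (fun _ _ => by positivity)
      (fun _ _ => by positivity) (fun j _ => ?_)
    rw [← mul_assoc, ← mul_pow]
    norm_num
  have h3 : ∑ j ∈ Finset.range n, (1 / 2 : ℝ) ^ j ≤ 2 := sum_geometric_two_le n
  have h4 : ∑ j ∈ Finset.range n, 2 ^ j * ‖x (j + 1) - x j‖ ^ 2 ≤ ∑' j, 2 ^ j * e j :=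
    (Finset.sum_le_sum fun j _ => by gcongr; exact he j).trans
      (hs.sum_le_tsum _ fun j _ => by have := he0 j; positivity)
  have h5 : ‖x n - x 0‖ ^ 2 ≤ 2 * ∑' j, 2 ^ j * e j :=
    calc ‖x n - x 0‖ ^ 2 ≤ (∑ j ∈ Finset.range n, ‖x (j + 1) - x j‖) ^ 2 := by gcongr
      _ ≤ _ := h2
      _ ≤ _ := by gcongr
  have h6 : ‖x n‖ ≤ ‖x 0‖ + ‖x n - x 0‖ := by
    simpa using norm_add_le (x 0) (x n - x 0)
  nlinarith [norm_nonneg (x n), sq_nonneg (‖x 0‖ - ‖x n - x 0‖), norm_nonneg (x 0),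
    norm_nonneg (x n - x 0)]

theorem abs_sub_grid_le (σ : ℝ) (hσ : 0 ≤ σ) (j : ℕ) :
    |(⌊σ * 16 ^ j⌋₊ : ℝ) / 16 ^ j - σ| ≤ (1 / 16) ^ j := by
  have hp : (0 : ℝ) < 16 ^ j := by positivity
  have h1 := Nat.floor_le (show 0 ≤ σ * 16 ^ j by positivity)
  have h2 := Nat.lt_floor_add_one (σ * 16 ^ j)
  rw [one_div, inv_pow, abs_le]
  constructor
  · rw [neg_le_sub_iff_le_add, ← one_div, ← add_div, le_div_iff₀ hp]
    exact h2.le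
  · rw [sub_le_iff_le_add, div_le_iff₀ hp, add_mul, inv_mul_cancel₀ hp.ne']
    linarith

/-- A curve in `H` that is Hölder continuous with exponent `3/4` has square summable suprema of
the components along an orthogonal family of subspaces. -/
theorem exists_sum_sup_le (V : ι → Submodule ℝ H) [∀ i, (V i).HasOrthogonalProjection]
    (hV : Pairwise fun i j => V i ⟂ V j) {γ : ℝ → H} {C M : ℝ}
    (hC : ∀ x ∈ Ico (0 : ℝ) 1, ∀ y ∈ Ico (0 : ℝ) 1, ‖γ x - γ y‖ ≤ C * |x - y| ^ (3 / 4 : ℝ))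
    (hM : ‖γ 0‖ ≤ M) :
    ∃ Q : ι → ℝ, (∀ i, ∀ σ ∈ Ico (0 : ℝ) 1, ‖(V i).starProjection (γ σ)‖ ^ 2 ≤ Q i) ∧
      ∀ s : Finset ι, ∑ i ∈ s, Q i ≤ 2 * M ^ 2 + 128 * C ^ 2 := by
  have hC0 : 0 ≤ C := by
    have h := (norm_nonneg _).trans (hC 0 (by norm_num) (1 / 2) (by norm_num))
    exact nonneg_of_mul_nonneg_left h (by positivity)
  -- Increment from a point of the grid of mesh `16^{-(j+1)}` to its parent in the grid of mesh
  -- `16^{-j}`. Base 16 makes `16^{3/4} = 8` exact.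
  set Δ : ℕ → ℕ → H := fun j k =>
    γ ((k : ℝ) / 16 ^ (j + 1)) - γ (((k / 16 : ℕ) : ℝ) / 16 ^ j) with hΔ
  have hpow : ∀ j : ℕ, ((1 / 16 : ℝ) ^ j) ^ (3 / 4 : ℝ) = (1 / 8) ^ j := by
    intro j
    rw [← Real.rpow_natCast, ← Real.rpow_mul (by norm_num), mul_comm, Real.rpow_mul (by norm_num),
      Real.rpow_natCast]
    congr 1
    rw [show (1 / 16 : ℝ) = (1 / 2) ^ (4 : ℝ) by norm_num, ← Real.rpow_mul (by norm_num)]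
    norm_num
  have hΔle : ∀ j, ∀ k ∈ Finset.range (16 ^ (j + 1)), ‖Δ j k‖ ^ 2 ≤ C ^ 2 * (1 / 64) ^ j := by
    intro j k hk
    have hk' : k < 16 ^ (j + 1) := Finset.mem_range.1 hk
    have hp : (0 : ℝ) < 16 ^ j := by positivity
    have hdm : (k : ℝ) = 16 * ((k / 16 : ℕ) : ℝ) + ((k % 16 : ℕ) : ℝ) := by
      exact_mod_cast (Nat.div_add_mod k 16).symm
    have hmod : ((k % 16 : ℕ) : ℝ) ≤ 16 := by exact_mod_cast (Nat.mod_lt k (by norm_num)).le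
    have h1 : (k : ℝ) / 16 ^ (j + 1) ∈ Ico (0 : ℝ) 1 :=
      ⟨by positivity, by rw [div_lt_one (by positivity)]; exact_mod_cast hk'⟩
    have h2 : ((k / 16 : ℕ) : ℝ) / 16 ^ j ∈ Ico (0 : ℝ) 1 := by
      refine ⟨by positivity, ?_⟩
      rw [div_lt_one (by positivity)]
      have : k / 16 < 16 ^ j := by
        rw [Nat.div_lt_iff_lt_mul (by norm_num), ← pow_succ]; exact hk'
      exact_mod_cast this
    have h3 : |(k : ℝ) / 16 ^ (j + 1) - ((k / 16 : ℕ) : ℝ) / 16 ^ j| ≤ (1 / 16) ^ j := by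
      have : (k : ℝ) / 16 ^ (j + 1) - ((k / 16 : ℕ) : ℝ) / 16 ^ j =
          ((k % 16 : ℕ) : ℝ) / 16 * (1 / 16) ^ j := by
        rw [hdm]
        rw [one_div, inv_pow]
        field_simp
        ring
      rw [this, abs_of_nonneg (by positivity)]
      exact mul_le_of_le_one_left (by positivity) (by linarith)
    have h4 : ‖Δ j k‖ ≤ C * (1 / 8) ^ j := by
      refine (hC _ h1 _ h2).trans ?_
      rw [← hpow]
      gcongr
    calc ‖Δ j k‖ ^ 2 ≤ (C * (1 / 8) ^ j) ^ 2 := by gcongr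
      _ = C ^ 2 * (1 / 64) ^ j := by
        rw [mul_pow, ← pow_mul, mul_comm j, pow_mul]
        norm_num
  set e : ι → ℕ → ℝ := fun i j =>
    ∑ k ∈ Finset.range (16 ^ (j + 1)), ‖(V i).starProjection (Δ j k)‖ ^ 2 with he
  -- The maximum over grid points is replaced by their sum in `e`. There are `16^{j+1}` increments,
  -- each of square at most `C² 64^{-j}`, so even with the weight `2^j` the total decays like
  -- `2^{-j}`. Exponent above 1/2 is what makes the count lose to the squares.
  have hesum : ∀ (s : Finset ι) j, ∑ i ∈ s, 2 ^ j * e i j ≤ 16 * C ^ 2 * (1 / 2) ^ j := by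
    intro s j
    rw [← Finset.mul_sum, he, Finset.sum_comm]
    calc (2 : ℝ) ^ j * ∑ k ∈ Finset.range (16 ^ (j + 1)),
          ∑ i ∈ s, ‖(V i).starProjection (Δ j k)‖ ^ 2
        ≤ 2 ^ j * ∑ k ∈ Finset.range (16 ^ (j + 1)), C ^ 2 * (1 / 64) ^ j := by
          gcongr with k hk
          exact (sum_norm_starProjection_sq_le V hV _ s).trans (hΔle j k hk)
      _ = 16 * C ^ 2 * (1 / 2) ^ j := by
          rw [Finset.sum_const, Finset.card_range, nsmul_eq_mul]
          push_cast
          rw [pow_succ, show (1 / 2 : ℝ) = 2 * 16 * (1 / 64) by norm_num, mul_pow, mul_pow]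
          ring
  have he0 : ∀ i j, 0 ≤ 2 ^ j * e i j := fun i j => by positivity
  have hgeo : Summable fun j : ℕ => 16 * C ^ 2 * (1 / 2 : ℝ) ^ j :=
    summable_geometric_two.mul_left _
  have hes : ∀ i, Summable fun j => 2 ^ j * e i j := fun i =>
    Summable.of_nonneg_of_le (he0 i) (fun j => by simpa using hesum {i} j) hgeo
  refine ⟨fun i => 2 * ‖(V i).starProjection (γ 0)‖ ^ 2 + 4 * ∑' j, 2 ^ j * e i j, ?_, ?_⟩
  · intro i σ hσ
    set x : ℕ → H := fun j => (V i).starProjection (γ ((⌊σ * 16 ^ j⌋₊ : ℝ) / 16 ^ j)) with hx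
    have hfl : ∀ j, ⌊σ * 16 ^ j⌋₊ < 16 ^ j := fun j => by
      rw [Nat.floor_lt (mul_nonneg hσ.1 (by positivity))]
      push_cast
      exact mul_lt_of_lt_one_left (by positivity) hσ.2
    have hx0 : x 0 = (V i).starProjection (γ 0) := by
      have := hfl 0
      simp only [hx, pow_zero, mul_one, div_one] at this ⊢
      rw [show ⌊σ⌋₊ = 0 by omega]
      simp
    have hlim : Filter.Tendsto x Filter.atTop (nhds ((V i).starProjection (γ σ))) := by
      refine ((V i).starProjection.continuous.tendsto _).comp ?_
      rw [tendsto_iff_norm_sub_tendsto_zero]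
      have h8 : Filter.Tendsto (fun j : ℕ => C * (1 / 8 : ℝ) ^ j) Filter.atTop (nhds 0) := by
        simpa using (tendsto_pow_atTop_nhds_zero_of_lt_one (r := (1 / 8 : ℝ))
          (by norm_num) (by norm_num)).const_mul C
      refine squeeze_zero (fun _ => norm_nonneg _) (fun j => ?_) h8
      refine (hC _ ⟨by positivity, ?_⟩ _ hσ).trans ?_
      · rw [div_lt_one (by positivity)]; exact_mod_cast hfl j
      · rw [← hpow]
        have := abs_sub_grid_le σ hσ.1 j
        gcongr
    beta_reduce
    rw [← hx0]
    refine norm_sq_le_of_chain hlim (fun j => ?_) (hes i)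
    -- Truncations of `σ` in base 16 are nested, so consecutive approximations differ by a parent
    -- increment `Δ`.
    have hdiv : ⌊σ * 16 ^ j⌋₊ = ⌊σ * 16 ^ (j + 1)⌋₊ / 16 := by
      have := Nat.floor_div_natCast (σ * 16 ^ (j + 1)) 16
      rw [← this]
      congr 1
      push_cast
      rw [pow_succ]
      ring
    have : x (j + 1) - x j = (V i).starProjection (Δ j ⌊σ * 16 ^ (j + 1)⌋₊) := by
      simp only [hx, hΔ, map_sub, hdiv]
    rw [this]
    exact Finset.single_le_sum (f := fun k => ‖(V i).starProjection (Δ j k)‖ ^ 2)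
      (fun _ _ => sq_nonneg _) (Finset.mem_range.2 (hfl (j + 1)))
  · intro s
    rw [Finset.sum_add_distrib, ← Finset.mul_sum, ← Finset.mul_sum,
      ← Summable.tsum_finsetSum fun i _ => hes i]
    have h1 : ∑' j, ∑ i ∈ s, 2 ^ j * e i j ≤ 32 * C ^ 2 := by
      refine ((summable_sum fun i _ => hes i).tsum_le_tsum (hesum s) hgeo).trans ?_
      rw [tsum_mul_left, tsum_geometric_two]
      linarith
    have h2 : ∑ i ∈ s, ‖(V i).starProjection (γ 0)‖ ^ 2 ≤ M ^ 2 :=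
      (sum_norm_starProjection_sq_le V hV _ s).trans (by gcongr)
    linarith

end Chaining

/-! ### Scalar estimates for the exponential multipliers. -/

/-- The multiplier `e^{-c t}`, with `c` and `t` replaced by their positive parts. -/
noncomputable def decay (t c : ℝ) : ℝ := Real.exp (-(max c 0 * max t 0))

theorem decay_pos (t c : ℝ) : 0 < decay t c := Real.exp_pos _

theorem decay_le_one (t c : ℝ) : decay t c ≤ 1 :=
  Real.exp_le_one_iff.2 (neg_nonpos.2 (by positivity))

theorem abs_decay_le_one (t c : ℝ) : |decay t c| ≤ 1 := by
  rw [abs_of_pos (decay_pos t c)]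
  exact decay_le_one t c

theorem decay_add {s t : ℝ} (hs : 0 ≤ s) (ht : 0 ≤ t) (c : ℝ) :
    decay (s + t) c = decay s c * decay t c := by
  rw [decay, decay, decay, ← Real.exp_add, max_eq_left hs, max_eq_left ht,
    max_eq_left (add_nonneg hs ht)]
  ring_nf

theorem decay_zero (c : ℝ) : decay 0 c = 1 := by simp [decay]

theorem continuous_decay (c : ℝ) : Continuous fun t => decay t c := by
  unfold decay
  fun_prop

theorem one_sub_decay_le {t : ℝ} (ht : 0 ≤ t) (c : ℝ) : 1 - decay t c ≤ max c 0 * t := by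
  have := Real.add_one_le_exp (-(max c 0 * max t 0))
  rw [max_eq_left ht] at this
  rw [decay, max_eq_left ht]
  linarith

theorem max_mul_decay_le {t : ℝ} (ht : 0 ≤ t) (c : ℝ) : max c 0 * t * decay t c ≤ 1 := by
  rw [decay, max_eq_left ht, Real.exp_neg, ← div_eq_mul_inv, div_le_one (Real.exp_pos _)]
  have := Real.add_one_le_exp (max c 0 * t)
  linarith

/-- The difference is at most 1 and at most `h / τ`, and `min 1 x ≤ x^{3/4}`. The resulting
singularity `τ^{-3/4}` is integrable. -/
theorem abs_decay_add_sub_le {h τ : ℝ} (hh : 0 ≤ h) (hτ : 0 < τ) (c : ℝ) :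
    |decay (h + τ) c - decay τ c| ≤ h ^ (3 / 4 : ℝ) * τ ^ (-(3 / 4) : ℝ) := by
  have h1 : h ^ (3 / 4 : ℝ) * τ ^ (-(3 / 4) : ℝ) = (h / τ) ^ (3 / 4 : ℝ) := by
    rw [Real.div_rpow hh hτ.le, Real.rpow_neg hτ.le, ← div_eq_mul_inv]
  have hp := decay_pos τ c
  have hle := decay_le_one h c
  have h0 := decay_pos h c
  rw [h1, decay_add hh hτ.le, abs_sub_comm, abs_of_nonneg (by nlinarith)]
  have hz1 : decay τ c - decay h c * decay τ c ≤ 1 := by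
    have := decay_le_one τ c
    nlinarith
  have hz2 : decay τ c - decay h c * decay τ c ≤ h / τ := by
    rw [le_div_iff₀ hτ]
    calc (decay τ c - decay h c * decay τ c) * τ = (1 - decay h c) * (τ * decay τ c) := by ring
      _ ≤ (max c 0 * h) * (τ * decay τ c) := by
        gcongr
        exact one_sub_decay_le hh c
      _ = h * (max c 0 * τ * decay τ c) := by ring
      _ ≤ h := mul_le_of_le_one_right hh (max_mul_decay_le hτ.le c)
  rcases le_total (h / τ) 1 with hr | hr
  · exact hz2.trans (Real.self_le_rpow_of_le_one (by positivity) hr (by norm_num))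
  · exact hz1.trans (Real.one_le_rpow hr (by norm_num))

/-! ### Regularity of mild solutions for the contraction semigroup. -/

section Flow

variable {H : Type*} [NormedAddCommGroup H] [InnerProductSpace ℝ H] [CompleteSpace H]
  {V : ℝ → Submodule ℝ H} [∀ i, (V i).HasOrthogonalProjection]
  (hV : Pairwise fun i j => V i ⟂ V j)

/-- The contraction semigroup with multipliers `decay t`. -/
noncomputable def flow (t : ℝ) : H →L[ℝ] H := diagonalCLM hV zero_le_one (abs_decay_le_one t)

theorem flow_apply (t : ℝ) (x : H) : flow hV t x = diagonal V (decay t) x := rfl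

theorem norm_flow_le (t : ℝ) (x : H) : ‖flow hV t x‖ ≤ ‖x‖ := by
  simpa [flow_apply] using norm_diagonal_le hV zero_le_one (abs_decay_le_one t) x

theorem flow_flow {s t : ℝ} (hs : 0 ≤ s) (ht : 0 ≤ t) (x : H) :
    flow hV s (flow hV t x) = flow hV (s + t) x := by
  simp only [flow_apply]
  rw [diagonal_diagonal hV (abs_decay_le_one t)]
  congr 1
  ext c
  rw [decay_add hs ht]

theorem starProjection_flow (t : ℝ) (x : H) (c : ℝ) :
    (V c).starProjection (flow hV t x) = decay t c • (V c).starProjection x :=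
  starProjection_diagonal hV (abs_decay_le_one t) x c

theorem continuous_flow {X : Type*} [TopologicalSpace X] {p : X → ℝ} (hp : Continuous p)
    {f : X → H} (hf : Continuous f) : Continuous fun s => flow hV (p s) (f s) :=
  continuous_diagonal hV zero_le_one (fun s => abs_decay_le_one (p s))
    (fun c => (continuous_decay c).comp hp) hf

theorem norm_flow_add_sub_le {h τ : ℝ} (hh : 0 ≤ h) (hτ : 0 < τ) (x : H) :
    ‖flow hV (h + τ) x - flow hV τ x‖ ≤ h ^ (3 / 4 : ℝ) * τ ^ (-(3 / 4) : ℝ) * ‖x‖ := by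
  rw [flow_apply, flow_apply, diagonal_sub_left hV (abs_decay_le_one _) (abs_decay_le_one _)]
  exact norm_diagonal_le hV (by positivity) (abs_decay_add_sub_le hh hτ) x

theorem norm_mild_integral_le {f : ℝ → H} {K : ℝ} (hK : ∀ s, 0 ≤ s → ‖f s‖ ≤ K) {a h : ℝ} (ha : 0 ≤ a)
    (hh : 0 ≤ h) : ‖∫ s in a..(a + h), flow hV (a + h - s) (f s)‖ ≤ K * h := by
  have := intervalIntegral.norm_integral_le_of_norm_le_const (a := a) (b := a + h) (C := K)
    (f := fun s => flow hV (a + h - s) (f s)) fun s hs => by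
      rw [uIoc_of_le (by linarith)] at hs
      exact (norm_flow_le hV _ _).trans (hK s (by linarith [hs.1]))
  simpa [abs_of_nonneg hh] using this

variable {u f : ℝ → H} (hf : Continuous f)
  (hu : ∀ t, 0 ≤ t → u t = flow hV t (u 0) + ∫ s in (0 : ℝ)..t, flow hV (t - s) (f s))

include hf hu

/-- The variation of constants formula, started at time `a`. -/
theorem mild_restart {a h : ℝ} (ha : 0 ≤ a) (hh : 0 ≤ h) :
    u (a + h) = flow hV h (u a) + ∫ s in a..(a + h), flow hV (a + h - s) (f s) := by
  have hi : ∀ t b c : ℝ, IntervalIntegrable (fun s => flow hV (t - s) (f s)) volume b c :=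
    fun t b c => (continuous_flow hV (by fun_prop) hf).intervalIntegrable b c
  rw [hu (a + h) (by positivity), hu a ha, map_add, flow_flow hV hh ha,
    ← ContinuousLinearMap.intervalIntegral_comp_comm _ (hi a 0 a), add_assoc,
    ← intervalIntegral.integral_add_adjacent_intervals (hi (a + h) 0 a) (hi (a + h) a (a + h)),
    add_comm h a]
  congr 2
  refine intervalIntegral.integral_congr fun s hs => ?_
  rw [uIcc_of_le ha] at hs
  rw [flow_flow hV hh (by linarith [hs.2])]
  congr 2
  ring

/-- A bounded mild solution with bounded forcing is Hölder continuous with exponent `3/4`. -/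
theorem norm_mild_sub_le_rpow {K M : ℝ} (hK : ∀ s, 0 ≤ s → ‖f s‖ ≤ K)
    (hM : ∀ s, 0 ≤ s → ‖u s‖ ≤ M) {a h : ℝ} (ha : 1 ≤ a) (hh : 0 ≤ h) :
    ‖u (a + h) - u a‖ ≤ (5 * K + 2 * M) * h ^ (3 / 4 : ℝ) := by
  have hK0 : 0 ≤ K := (norm_nonneg _).trans (hK 0 le_rfl)
  have hM0 : 0 ≤ M := (norm_nonneg _).trans (hM 0 le_rfl)
  have hp0 : 0 ≤ h ^ (3 / 4 : ℝ) := by positivity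
  rcases le_total 1 h with h1 | h1
  · have h2 : (1 : ℝ) ≤ h ^ (3 / 4 : ℝ) := Real.one_le_rpow h1 (by norm_num)
    have h3 := norm_sub_le (u (a + h)) (u a)
    have h4 := hM (a + h) (by linarith)
    have h5 := hM a (by linarith)
    nlinarith
  have hhp : h ≤ h ^ (3 / 4 : ℝ) := Real.self_le_rpow_of_le_one hh h1 (by norm_num)
  have hi : ∀ t : ℝ, IntervalIntegrable (fun s => flow hV (t - s) (f s)) volume (a - 1) a :=
    fun t => (continuous_flow hV (by fun_prop) hf).intervalIntegrable _ _
  -- Restarting one time unit earlier keeps the constants independent of `a`.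
  have hua : u a = flow hV 1 (u (a - 1)) + ∫ s in (a - 1)..a, flow hV (a - s) (f s) := by
    have := mild_restart hV hf hu (a := a - 1) (h := 1) (by linarith) zero_le_one
    simpa using this
  have hI : flow hV h (∫ s in (a - 1)..a, flow hV (a - s) (f s)) -
      ∫ s in (a - 1)..a, flow hV (a - s) (f s) =
      ∫ s in (a - 1)..a, (flow hV (h + (a - s)) (f s) - flow hV (a - s) (f s)) := by
    rw [← ContinuousLinearMap.intervalIntegral_comp_comm _ (hi a),
      ← intervalIntegral.integral_sub _ (hi a)]
    · refine intervalIntegral.integral_congr fun s hs => ?_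
      rw [uIcc_of_le (by linarith)] at hs
      rw [flow_flow hV hh (by linarith [hs.2])]
    · exact ((flow hV h).continuous.comp
        (continuous_flow hV (by fun_prop) hf)).intervalIntegrable _ _
  have hint : IntervalIntegrable (fun s => (a - s) ^ (-(3 / 4) : ℝ)) volume (a - 1) a := by
    have := (intervalIntegral.intervalIntegrable_rpow' (r := -(3 / 4)) (a := 1) (b := 0)
      (by norm_num)).comp_sub_left a
    simpa using this
  -- The 4 is `∫₀¹ τ^{-3/4} dτ`.
  have hIle : ‖∫ s in (a - 1)..a, (flow hV (h + (a - s)) (f s) - flow hV (a - s) (f s))‖ ≤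
      4 * K * h ^ (3 / 4 : ℝ) := by
    have hb : ∀ᵐ s : ℝ, s ∈ Ioc (a - 1) a →
        ‖flow hV (h + (a - s)) (f s) - flow hV (a - s) (f s)‖ ≤
          h ^ (3 / 4 : ℝ) * K * (a - s) ^ (-(3 / 4) : ℝ) := by
      -- At `s = a` the bound reads `0 ^ (-3/4)`, which is `0` by convention, so this point is
      -- discarded.
      have hne : ∀ᵐ s : ℝ, s ≠ a := by simp [ae_iff]
      filter_upwards [hne] with s hs hmem
      have hlt : 0 < a - s := sub_pos.2 (lt_of_le_of_ne hmem.2 hs)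
      refine (norm_flow_add_sub_le hV hh hlt _).trans ?_
      rw [mul_right_comm]
      gcongr
      exact hK s (by linarith [hmem.1])
    refine (intervalIntegral.norm_integral_le_of_norm_le (by linarith) hb
      (hint.const_mul _)).trans (le_of_eq ?_)
    rw [intervalIntegral.integral_const_mul,
      intervalIntegral.integral_comp_sub_left (fun x => x ^ (-(3 / 4) : ℝ)) a,
      integral_rpow (Or.inl (by norm_num))]
    norm_num
    ring
  have h2 : ‖flow hV h (flow hV 1 (u (a - 1))) - flow hV 1 (u (a - 1))‖ ≤
      M * h ^ (3 / 4 : ℝ) := by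
    rw [flow_flow hV hh zero_le_one]
    refine (norm_flow_add_sub_le hV hh one_pos _).trans ?_
    rw [Real.one_rpow, mul_one, mul_comm]
    gcongr
    exact hM _ (by linarith)
  have h3 := norm_mild_integral_le hV hK (a := a) (by linarith) hh
  rw [mild_restart hV hf hu (by linarith) hh]
  have h4 : flow hV h (u a) + (∫ s in a..(a + h), flow hV (a + h - s) (f s)) - u a =
      (flow hV h (flow hV 1 (u (a - 1))) - flow hV 1 (u (a - 1))) +
      (∫ s in (a - 1)..a, (flow hV (h + (a - s)) (f s) - flow hV (a - s) (f s))) +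
      ∫ s in a..(a + h), flow hV (a + h - s) (f s) := by
    rw [← hI]
    nth_rewrite 2 [hua]
    rw [hua, map_add]
    abel
  rw [h4]
  refine (norm_add₃_le).trans ?_
  nlinarith

/-- A mild solution whose forcing has square summable suprema of components is Lipschitz. -/
theorem norm_mild_sub_le_mul {K M K₂ : ℝ} (hK : ∀ s, 0 ≤ s → ‖f s‖ ≤ K)
    (hM : ∀ s, 0 ≤ s → ‖u s‖ ≤ M) {a h : ℝ} (ha : 1 ≤ a) (hh : 0 ≤ h) {Q : ℝ → ℝ}
    (hQ : ∀ c, ∀ s ∈ Icc (a - 1) a, ‖(V c).starProjection (f s)‖ ^ 2 ≤ Q c)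
    (hK₂ : ∀ s : Finset ℝ, ∑ c ∈ s, Q c ≤ K₂) :
    ‖u (a + h) - u a‖ ≤ (√(2 * M ^ 2 + 2 * K₂) + K) * h := by
  have hua : u a = flow hV 1 (u (a - 1)) + ∫ s in (a - 1)..a, flow hV (a - s) (f s) := by
    have := mild_restart hV hf hu (a := a - 1) (h := 1) (by linarith) zero_le_one
    simpa using this
  have hi : ∀ t b c : ℝ, IntervalIntegrable (fun s => flow hV (t - s) (f s)) volume b c :=
    fun t b c => (continuous_flow hV (by fun_prop) hf).intervalIntegrable b c
  -- `flow hV 0` is the projection onto the closed span of the `V c`, which is not assumed to be all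
  -- of `H`; but `u a` is built from values of the flow and lies in its range.
  have hfix : flow hV 0 (u a) = u a := by
    rw [hua, map_add, flow_flow hV le_rfl zero_le_one, zero_add,
      ← ContinuousLinearMap.intervalIntegral_comp_comm _ (hi a _ _)]
    congr 1
    refine intervalIntegral.integral_congr fun s hs => ?_
    rw [uIcc_of_le (by linarith)] at hs
    rw [flow_flow hV le_rfl (by linarith [hs.2]), zero_add]
  -- The componentwise bound for `A u(a)`: `c e^{-c} ≤ 1` handles the initial value, and `c
  -- e^{-c(a-s)}` has integral at most 1 over the unit interval.
  have hcomp : ∀ c, max c 0 * ‖(V c).starProjection (u a)‖ ≤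
      ‖(V c).starProjection (u (a - 1))‖ + √(Q c) := by
    intro c
    have hc0 : 0 ≤ max c 0 := le_max_right _ _
    have hsq : ∀ s ∈ Icc (a - 1) a, ‖(V c).starProjection (f s)‖ ≤ √(Q c) := fun s hs =>
      Real.le_sqrt_of_sq_le (hQ c s hs)
    have hd : ∀ s, HasDerivAt (fun s => Real.exp (-(max c 0 * (a - s))) * √(Q c))
        (max c 0 * Real.exp (-(max c 0 * (a - s))) * √(Q c)) s := by
      intro s
      have := ((((hasDerivAt_id s).const_sub a).const_mul (max c 0)).neg.exp).mul_const (√(Q c))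
      refine this.congr_deriv ?_
      simp only [id, mul_neg, mul_one, neg_neg, Pi.neg_apply]
      ring
    have hint : ‖max c 0 • ∫ s in (a - 1)..a, decay (a - s) c • (V c).starProjection (f s)‖ ≤
        √(Q c) := by
      rw [← intervalIntegral.integral_smul]
      have hb : ∀ᵐ s : ℝ, s ∈ Ioc (a - 1) a →
          ‖max c 0 • decay (a - s) c • (V c).starProjection (f s)‖ ≤
            max c 0 * Real.exp (-(max c 0 * (a - s))) * √(Q c) := by
        refine Filter.Eventually.of_forall fun s hs => ?_
        rw [norm_smul, norm_smul, Real.norm_of_nonneg hc0, Real.norm_of_nonneg (decay_pos _ _).le,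
          decay, max_eq_left (by linarith [hs.2] : 0 ≤ a - s), mul_assoc]
        gcongr
        exact hsq s ⟨hs.1.le, hs.2⟩
      have hcont : Continuous fun s => max c 0 * Real.exp (-(max c 0 * (a - s))) * √(Q c) := by
        fun_prop
      refine (intervalIntegral.norm_integral_le_of_norm_le (by linarith) hb
        (hcont.intervalIntegrable _ _)).trans ?_
      rw [intervalIntegral.integral_eq_sub_of_hasDerivAt (fun s _ => hd s)
        (hcont.intervalIntegrable _ _)]
      have : 0 ≤ Real.exp (-(max c 0 * (a - (a - 1)))) * √(Q c) := by positivity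
      simp only [sub_self, mul_zero, neg_zero, Real.exp_zero, one_mul]
      linarith
    have hP : (V c).starProjection (u a) = decay 1 c • (V c).starProjection (u (a - 1)) +
        ∫ s in (a - 1)..a, decay (a - s) c • (V c).starProjection (f s) := by
      rw [hua, map_add, starProjection_flow,
        ← ContinuousLinearMap.intervalIntegral_comp_comm _ (hi a _ _)]
      simp only [starProjection_flow]
    rw [← norm_smul_of_nonneg hc0, hP, smul_add]
    refine (norm_add_le _ _).trans (add_le_add ?_ hint)
    rw [smul_smul, norm_smul, Real.norm_of_nonneg (mul_nonneg hc0 (decay_pos _ _).le)]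
    have := max_mul_decay_le zero_le_one c
    rw [mul_one] at this
    exact mul_le_of_le_one_left (norm_nonneg _) this
  have hQ0 : ∀ c, 0 ≤ Q c := fun c =>
    (sq_nonneg _).trans (hQ c a ⟨by linarith, le_rfl⟩)
  -- Since `1 - e^{-ch} ≤ ch`, this is `h` times the bound for `A u(a)` given by `hcomp`.
  have hmain : ‖flow hV h (u a) - u a‖ ≤ √(2 * M ^ 2 + 2 * K₂) * h := by
    nth_rewrite 2 [← hfix]
    rw [flow_apply, flow_apply, diagonal_sub_left hV (abs_decay_le_one _) (abs_decay_le_one _)]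
    have hsq : ‖diagonal V (decay h - decay 0) (u a)‖ ^ 2 ≤ (2 * M ^ 2 + 2 * K₂) * h ^ 2 := by
      refine norm_diagonal_sq_le hV fun s => ?_
      have hterm : ∀ c, ‖(decay h - decay 0) c • (V c).starProjection (u a)‖ ^ 2 ≤
          (2 * ‖(V c).starProjection (u (a - 1))‖ ^ 2 + 2 * Q c) * h ^ 2 := by
        intro c
        have h1 : ‖(decay h - decay 0) c • (V c).starProjection (u a)‖ ≤
            h * (‖(V c).starProjection (u (a - 1))‖ + √(Q c)) := by
          rw [norm_smul, Pi.sub_apply, decay_zero, Real.norm_eq_abs, abs_sub_comm,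
            abs_of_nonneg (by linarith [decay_le_one h c])]
          calc (1 - decay h c) * ‖(V c).starProjection (u a)‖
              ≤ max c 0 * h * ‖(V c).starProjection (u a)‖ := by
                gcongr
                exact one_sub_decay_le hh c
            _ = h * (max c 0 * ‖(V c).starProjection (u a)‖) := by ring
            _ ≤ _ := by gcongr; exact hcomp c
        calc _ ≤ (h * (‖(V c).starProjection (u (a - 1))‖ + √(Q c))) ^ 2 := by gcongr
          _ ≤ h ^ 2 * (2 * (‖(V c).starProjection (u (a - 1))‖ ^ 2 + √(Q c) ^ 2)) := by
            rw [mul_pow]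
            gcongr
            exact add_sq_le
          _ = _ := by rw [Real.sq_sqrt (hQ0 c)]; ring
      refine (Finset.sum_le_sum fun c _ => hterm c).trans ?_
      rw [← Finset.sum_mul, Finset.sum_add_distrib, ← Finset.mul_sum, ← Finset.mul_sum]
      gcongr
      · refine (sum_norm_starProjection_sq_le V hV _ s).trans ?_
        have := hM (a - 1) (by linarith)
        gcongr
      · exact hK₂ s
    rw [← Real.sqrt_sq hh, ← Real.sqrt_mul' _ (sq_nonneg h)]
    refine Real.le_sqrt_of_sq_le ?_
    rwa [Real.sqrt_sq hh]
  have h3 := norm_mild_integral_le hV hK (a := a) (by linarith) hh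
  rw [mild_restart hV hf hu (by linarith) hh, add_sub_right_comm, add_mul]
  exact (norm_add_le _ _).trans (add_le_add hmain h3)

end Flow

/-! ### Identification of `semigroup A` with the flow on the eigenspaces of `A`. -/

section Spectral

variable {H : Type*} [NormedAddCommGroup H] [InnerProductSpace ℝ H] {A : H →ₗ.[ℝ] H}

theorem inner_apply_eq_of_isSelfAdjoint [CompleteSpace H] (hA : IsSelfAdjoint A)
    (hdense : Dense (A.domain : Set H)) (x y : A.domain) : ⟪A x, (y : H)⟫ = ⟪(x : H), A y⟫ := by
  have h := LinearPMap.adjoint_isFormalAdjoint (T := A) hdense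
  rw [LinearPMap.isSelfAdjoint_def.1 hA] at h
  exact h x y

theorem isOrtho_closure_eigenspace (hA : ∀ x y : A.domain, ⟪A x, (y : H)⟫ = ⟪(x : H), A y⟫) :
    Pairwise fun c c' =>
      (eigenspace A c).topologicalClosure ⟂ (eigenspace A c').topologicalClosure := by
  intro c c' hne
  have h : eigenspace A c ⟂ eigenspace A c' := by
    rw [Submodule.isOrtho_iff_inner_eq]
    rintro _ ⟨x, rfl, hx⟩ _ ⟨y, rfl, hy⟩
    have := hA x y
    rw [hx, hy, inner_smul_left, inner_smul_right] at this
    have h0 : (c - c') * ⟪(x : H), (y : H)⟫ = 0 := by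
      simp only [conj_trivial] at this
      linarith
    exact (mul_eq_zero.1 h0).resolve_left (sub_ne_zero.2 hne)
  have h1 : (eigenspace A c).topologicalClosure ⟂ eigenspace A c' :=
    Submodule.topologicalClosure_minimal _ h (Submodule.isClosed_orthogonal _)
  exact Submodule.IsOrtho.symm
    (Submodule.topologicalClosure_minimal _ h1.symm (Submodule.isClosed_orthogonal _))

theorem closure_eigenspace_eq_bot (hpos : ∀ x : A.domain, 0 ≤ ⟪A x, (x : H)⟫) {c : ℝ}
    (hc : c < 0) : (eigenspace A c).topologicalClosure = ⊥ := by
  have h : eigenspace A c ≤ ⊥ := by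
    rintro _ ⟨x, rfl, hx⟩
    have h1 := hpos x
    rw [hx, inner_smul_left, real_inner_self_eq_norm_sq] at h1
    simp only [conj_trivial] at h1
    have h2 : ‖(x : H)‖ = 0 := by
      by_contra hne
      have : 0 < ‖(x : H)‖ ^ 2 := by positivity
      nlinarith
    simpa using h2
  exact le_bot_iff.1 (Submodule.topologicalClosure_minimal _ h isClosed_singleton)

/-- Nonnegativity of `A` kills the eigenspaces at `c < 0`, so the positive parts in `decay` change
nothing for `t ≥ 0`. -/
theorem semigroup_eq_flow [CompleteSpace H]
    (hV : Pairwise fun c c' =>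
      (eigenspace A c).topologicalClosure ⟂ (eigenspace A c').topologicalClosure)
    (hpos : ∀ x : A.domain, 0 ≤ ⟪A x, (x : H)⟫) {t : ℝ} (ht : 0 ≤ t) (x : H) :
    semigroup A t x = flow hV t x := by
  rw [flow_apply]
  refine tsum_congr fun c => ?_
  rcases lt_or_ge c 0 with hc | hc
  · have hx := (eigenspace A c).topologicalClosure.starProjection_apply_mem x
    have h0 : (eigenspace A c).topologicalClosure.starProjection x = 0 := by
      rw [← Submodule.mem_bot ℝ, ← closure_eigenspace_eq_bot hpos hc]
      exact hx
    rw [h0, smul_zero, smul_zero]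
  · rw [decay, max_eq_left hc, max_eq_left ht]

end Spectral

/-! ### Application to the delay equation and its attractor. -/

section Regularity

variable {H : Type*} [NormedAddCommGroup H] {r : ℝ}

theorem continuous_valueAt (w : C(Ici (-r), H)) : Continuous (valueAt w) := by
  unfold valueAt
  fun_prop

theorem continuous_segment (w : C(Ici (-r), H)) : Continuous (segment w) := by
  refine ContinuousMap.continuous_of_continuous_uncurry _ ?_
  exact (continuous_valueAt w).comp (by fun_prop)

theorem continuous_delayTerm {B : H → H} (hB : Continuous B) {η : Phase r H → Icc (0 : ℝ) r}
    (hη : Continuous η) : Continuous (delayTerm B η) := by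
  have h1 : Continuous (negPoint (r := r)) := by
    unfold negPoint
    fun_prop
  exact hB.comp (continuous_eval.comp (continuous_id.prodMk (h1.comp hη)))

theorem norm_valueAt_le (hr : 0 ≤ r) {w : C(Ici (-r), H)} {M : ℝ}
    (hM : ∀ t, 0 ≤ t → ‖segment w t‖ ≤ M) {s : ℝ} (hs : 0 ≤ s) : ‖valueAt w s‖ ≤ M := by
  have h := ((segment w s).norm_coe_le_norm ⟨0, by simpa using hr, le_rfl⟩).trans (hM s hs)
  simpa [segment] using h

theorem norm_lipschitz_le {B : H → H} {LB : ℝ≥0} (hB : LipschitzWith LB B) {x : H} {M : ℝ}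
    (hx : ‖x‖ ≤ M) : ‖B x‖ ≤ ‖B 0‖ + LB * M := by
  have h1 : ‖B x - B 0‖ ≤ LB * ‖x‖ := by simpa [dist_eq_norm] using hB.dist_le_mul x 0
  have h2 : ‖B x‖ ≤ ‖B 0‖ + ‖B x - B 0‖ := by simpa using norm_add_le (B 0) (B x - B 0)
  have h3 : (LB : ℝ) * ‖x‖ ≤ LB * M := by gcongr
  linarith

/-- Transports a Hölder bound from a time window of length `ℓ` to the unit interval on which the
chaining estimate is stated. -/
theorem norm_rescale_sub_le {g : ℝ → H} {C : ℝ} {b ℓ : ℝ} (hb : 1 ≤ b) (hℓ : 0 ≤ ℓ)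
    (hg : ∀ x, 1 ≤ x → ∀ y, 1 ≤ y → ‖g x - g y‖ ≤ C * |x - y| ^ (3 / 4 : ℝ)) :
    ∀ x ∈ Ico (0 : ℝ) 1, ∀ y ∈ Ico (0 : ℝ) 1,
      ‖g (b + ℓ * x) - g (b + ℓ * y)‖ ≤ C * ℓ ^ (3 / 4 : ℝ) * |x - y| ^ (3 / 4 : ℝ) := by
  intro x hx y hy
  have h := hg (b + ℓ * x) (by nlinarith [hx.1]) (b + ℓ * y) (by nlinarith [hy.1])
  rwa [add_sub_add_left_eq_sub, ← mul_sub, abs_mul, abs_of_nonneg hℓ,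
    Real.mul_rpow hℓ (abs_nonneg _), ← mul_assoc] at h

variable [InnerProductSpace ℝ H] [CompleteSpace H]

/-- Bounded mild solutions are Lipschitz, uniformly in terms of the bound, from the time
`r + 2` on. -/
theorem exists_lipschitz_of_bounded {A : H →ₗ.[ℝ] H} (hA : IsSelfAdjoint A)
    (hdense : Dense (A.domain : Set H)) (hpos : ∀ x : A.domain, 0 ≤ ⟪A x, (x : H)⟫)
    {d : ℝ} (hd : 0 ≤ d) (hr : 0 ≤ r) {B : H → H} {LB : ℝ≥0} (hB : LipschitzWith LB B)
    {η : Phase r H → Icc (0 : ℝ) r} (hη : Continuous η) {M : ℝ} (hM0 : 0 ≤ M) :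
    ∃ L' : ℝ≥0, ∀ (φ : Phase r H) (w : C(Ici (-r), H)), IsMildSolution A d B η φ w →
      (∀ t, 0 ≤ t → ‖segment w t‖ ≤ M) → ∀ a, r + 2 ≤ a → ∀ h, 0 ≤ h →
        ‖valueAt w (a + h) - valueAt w a‖ ≤ L' * h := by
  set KB : ℝ := ‖B 0‖ + LB * M with hKB
  have hKB0 : 0 ≤ KB := by positivity
  set K : ℝ := KB + d * M with hK
  have hK0 : 0 ≤ K := by positivity
  set C : ℝ := 5 * K + 2 * M with hC
  have hC0 : 0 ≤ C := by positivity
  -- Chaining bounds for `B ∘ u` and `u` on a window of length `r + 2`.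
  set S₁ : ℝ := 2 * KB ^ 2 + 128 * (LB * C * (r + 2) ^ (3 / 4 : ℝ)) ^ 2 with hS₁
  set S₂ : ℝ := 2 * M ^ 2 + 128 * (C * (r + 2) ^ (3 / 4 : ℝ)) ^ 2 with hS₂
  refine ⟨⟨√(2 * M ^ 2 + 2 * (2 * S₁ + 2 * d ^ 2 * S₂)) + K, by positivity⟩, ?_⟩
  intro φ w hw hM a ha h hh
  have hV := isOrtho_closure_eigenspace (inner_apply_eq_of_isSelfAdjoint hA hdense)
  set u : ℝ → H := valueAt w with hu_def
  set f : ℝ → H := fun s => delayTerm B η (segment w s) - d • u s with hf_def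
  have hf : Continuous f :=
    ((continuous_delayTerm hB.continuous hη).comp (continuous_segment w)).sub
      ((continuous_valueAt w).const_smul d)
  have hu : ∀ t, 0 ≤ t → u t = flow hV t (u 0) + ∫ s in (0 : ℝ)..t, flow hV (t - s) (f s) := by
    intro t ht
    refine (hw.2 t ht).trans ?_
    rw [semigroup_eq_flow hV hpos ht]
    congr 1
    refine intervalIntegral.integral_congr fun s hs => ?_
    rw [uIcc_of_le ht] at hs
    exact semigroup_eq_flow hV hpos (by linarith [hs.2]) _
  have huM : ∀ s, 0 ≤ s → ‖u s‖ ≤ M := fun s hs => norm_valueAt_le hr hM hs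
  have hfK : ∀ s, 0 ≤ s → ‖f s‖ ≤ K := by
    intro s hs
    refine (norm_sub_le _ _).trans (add_le_add ?_ ?_)
    · exact norm_lipschitz_le hB (((segment w s).norm_coe_le_norm _).trans (hM s hs))
    · rw [norm_smul, Real.norm_of_nonneg hd]
      gcongr
      exact huM s hs
  have hHolder : ∀ x, 1 ≤ x → ∀ y, 1 ≤ y → ‖u x - u y‖ ≤ C * |x - y| ^ (3 / 4 : ℝ) := by
    have key : ∀ x, 1 ≤ x → ∀ y, x ≤ y → ‖u y - u x‖ ≤ C * |y - x| ^ (3 / 4 : ℝ) := by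
      intro x hx y hxy
      have := norm_mild_sub_le_rpow hV hf hu hfK huM hx (sub_nonneg.2 hxy)
      rwa [add_sub_cancel, ← abs_of_nonneg (sub_nonneg.2 hxy)] at this
    intro x hx y hy
    rcases le_total x y with hxy | hxy
    · rw [norm_sub_rev, abs_sub_comm]
      exact key x hx y hxy
    · exact key y hy x hxy
  have hBHolder : ∀ x, 1 ≤ x → ∀ y, 1 ≤ y →
      ‖B (u x) - B (u y)‖ ≤ LB * C * |x - y| ^ (3 / 4 : ℝ) := by
    intro x hx y hy
    rw [← dist_eq_norm, mul_assoc]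
    refine (hB.dist_le_mul _ _).trans ?_
    rw [dist_eq_norm]
    gcongr
    exact hHolder x hx y hy
  have hb : 1 ≤ a - 1 - r := by linarith
  obtain ⟨Q₁, hQ₁, hQ₁s⟩ := exists_sum_sup_le _ hV
    (γ := fun x => B (u (a - 1 - r + (r + 2) * x))) (M := KB)
    (norm_rescale_sub_le (g := fun x => B (u x)) hb (by linarith) hBHolder)
    (norm_lipschitz_le hB (huM _ (by linarith)))
  obtain ⟨Q₂, hQ₂, hQ₂s⟩ := exists_sum_sup_le _ hV
    (γ := fun x => u (a - 1 - r + (r + 2) * x)) (M := M)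
    (norm_rescale_sub_le (g := u) hb (by linarith) hHolder) (huM _ (by linarith))
  -- The forcing on `[a - 1, a]` sees `u` only on `[a - 1 - r, a]`. As the chaining interval is
  -- half-open, the window is extended beyond `a`; `a ≥ r + 2` keeps it in the Hölder range `[1,
  -- ∞)`.
  have hcover : ∀ s ∈ Icc (a - 1 - r) a, ∃ σ ∈ Ico (0 : ℝ) 1, s = a - 1 - r + (r + 2) * σ := by
    intro s hs
    have hr2 : 0 < r + 2 := by linarith
    refine ⟨(s - (a - 1 - r)) / (r + 2), ⟨div_nonneg (by linarith [hs.1]) hr2.le, ?_⟩, ?_⟩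
    · rw [div_lt_one hr2]; linarith [hs.2]
    · field_simp
      ring
  have hlip := norm_mild_sub_le_mul hV hf hu hfK huM (a := a) (by linarith) hh
    (Q := fun c => 2 * Q₁ c + 2 * d ^ 2 * Q₂ c) (K₂ := 2 * S₁ + 2 * d ^ 2 * S₂) ?_ ?_
  · exact hlip
  · intro c s hs
    set p := (eigenspace A c).topologicalClosure.starProjection
    set θ := negPoint (η (segment w s))
    -- Whatever value in `[0, r]` the delay takes, the delayed time stays in the window, where the
    -- supremum bound holds.
    obtain ⟨σ₁, hσ₁, hs₁⟩ := hcover (s + θ) ⟨by linarith [θ.2.1, hs.1], by linarith [θ.2.2, hs.2]⟩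
    obtain ⟨σ₂, hσ₂, hs₂⟩ := hcover s ⟨by linarith [hs.1], hs.2⟩
    have h1 : ‖p (B (u (s + θ)))‖ ^ 2 ≤ Q₁ c := by rw [hs₁]; exact hQ₁ c σ₁ hσ₁
    have h2 : ‖p (u s)‖ ^ 2 ≤ Q₂ c := by rw [hs₂]; exact hQ₂ c σ₂ hσ₂
    have h3 : p (f s) = p (B (u (s + θ))) - d • p (u s) := by
      rw [← map_smul, ← map_sub]
      rfl
    calc ‖p (f s)‖ ^ 2 ≤ (‖p (B (u (s + θ)))‖ + d * ‖p (u s)‖) ^ 2 := by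
          rw [h3]
          gcongr
          refine (norm_sub_le _ _).trans_eq ?_
          rw [norm_smul, Real.norm_of_nonneg hd]
      _ ≤ 2 * (‖p (B (u (s + θ)))‖ ^ 2 + (d * ‖p (u s)‖) ^ 2) := add_sq_le
      _ = 2 * ‖p (B (u (s + θ)))‖ ^ 2 + 2 * d ^ 2 * ‖p (u s)‖ ^ 2 := by ring
      _ ≤ 2 * Q₁ c + 2 * d ^ 2 * Q₂ c := by gcongr
  · intro s
    rw [Finset.sum_add_distrib, ← Finset.mul_sum, ← Finset.mul_sum]
    gcongr
    · exact hQ₁s s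
    · exact hQ₂s s

/-- A compact global attractor of the evolution operator consists of uniformly Lipschitz
functions.  Of the delay only continuity is needed: `u` is Hölder continuous with exponent
`3/4 > 1/2`, hence so is `B ∘ u`, and such curves have square summable suprema of their spectral
components, a property that survives any reparametrization `s ↦ s - η(u_s)` of time and bounds
`A u`.  By invariance every point of the attractor is `u_T` for a mild solution that stays in the
attractor, with `T` as large as needed; uniqueness of mild solutions is not used. -/
theorem attractor_subset_lipschitzClass {A : H →ₗ.[ℝ] H} (hA : IsSelfAdjoint A)
    (hdense : Dense (A.domain : Set H)) (hpos : ∀ x : A.domain, 0 ≤ ⟪A x, (x : H)⟫)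
    {d : ℝ} (hd : 0 ≤ d) (hr : 0 ≤ r) {B : H → H} {LB : ℝ≥0} (hB : LipschitzWith LB B)
    {η : Phase r H → Icc (0 : ℝ) r} (hη : Continuous η) {K : Set (Phase r H)}
    (hK : IsGlobalAttractor (evolution A d B η) K) :
    ∃ L' : ℝ≥0, K ⊆ lipschitzClass r H L' := by
  obtain ⟨M, hM0, hM⟩ := hK.isCompact.isBounded.exists_pos_norm_le
  obtain ⟨L', hL'⟩ := exists_lipschitz_of_bounded hA hdense hpos hd hr hB hη hM0.le
  refine ⟨L', fun φ hφ => ?_⟩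
  -- The segment at time `2r + 2` covers `[r + 2, 2r + 2]`, where the Lipschitz bound is available.
  have hT : 0 ≤ 2 * r + 2 := by linarith
  rw [← hK.invariant _ hT] at hφ
  obtain ⟨ψ, hψ, rfl⟩ := hφ
  have hmem : ∀ t, 0 ≤ t → evolution A d B η t ψ ∈ K := fun t ht => by
    rw [← hK.invariant t ht]
    exact mem_image_of_mem _ hψ
  by_cases hex : ∃ u : C(Ici (-r), H), IsMildSolution A d B η ψ u
  · have hS : ∀ t, evolution A d B η t ψ = segment hex.choose t := fun t => dif_pos hex
    have hlip := hL' ψ hex.choose hex.choose_spec fun t ht => by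
      rw [← hS t]; exact hM _ (hmem t ht)
    have key : ∀ x y : Icc (-r) (0 : ℝ), (x : ℝ) ≤ y →
        dist (segment hex.choose (2 * r + 2) y) (segment hex.choose (2 * r + 2) x) ≤
          L' * dist y x := by
      intro x y hxy
      have := hlip (2 * r + 2 + x) (by linarith [x.2.1]) (y - x) (sub_nonneg.2 hxy)
      rw [add_assoc, add_sub_cancel] at this
      rw [Subtype.dist_eq, Real.dist_eq, abs_of_nonneg (sub_nonneg.2 hxy), dist_eq_norm]
      exact this
    rw [hS]
    refine LipschitzWith.of_dist_le_mul fun x y => ?_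
    rcases le_total (x : ℝ) y with hxy | hxy
    · rw [dist_comm, dist_comm x y]
      exact key x y hxy
    · exact key y x hxy
  -- Without a mild solution, `evolution` takes its default value `0`, which is Lipschitz.
  · rw [evolution, dif_neg hex]
    exact LipschitzWith.of_dist_le_mul fun x y => by simp; positivity

end Regularity

end DelayPDE

theorem mainTheorem4 {n : ℕ} (Ω : Set (EuclideanSpace ℝ (Fin n)))
    (hΩ_open : IsOpen Ω) (hΩ_conn : IsConnected Ω) (hΩ_bdd : Bornology.IsBounded Ω)
    (A : DelayPDE.L2 Ω →ₗ.[ℝ] DelayPDE.L2 Ω)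
    (hA_dense : Dense (A.domain : Set (DelayPDE.L2 Ω)))
    (hA_selfAdjoint : IsSelfAdjoint A)
    (hA_pos : ∀ x : A.domain, 0 ≤ ⟪A x, (x : DelayPDE.L2 Ω)⟫)
    (hA_compact : DelayPDE.HasCompactResolvent A)
    (d : ℝ) (hd : 0 ≤ d) (r : ℝ) (hr : 0 < r)
    (B : DelayPDE.L2 Ω → DelayPDE.L2 Ω) (LB : ℝ≥0) (hB : LipschitzWith LB B)
    (Θu Θl η : DelayPDE.Phase r (DelayPDE.L2 Ω) → Icc (0 : ℝ) r)
    (hΘ : ∀ φ, Θl φ ≤ Θu φ)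
    (hΘu : Continuous Θu) (hΘl : Continuous Θl)
    (L : ℝ≥0) (hZ : DelayPDE.zeroSet Θl ⊆ DelayPDE.lipschitzClass r (DelayPDE.L2 Ω) L)
    (hη : Continuous η) (hη_ignores : DelayPDE.IgnoresOutside Θu Θl η)
    (hη_pos : ∀ φ ∈ DelayPDE.zeroSet Θl, 0 < (η φ : ℝ))
    (hη_lip : ∃ ω : ℝ, 0 < ω ∧ ∃ Lη : ℝ, 0 < Lη ∧
      ∀ φ ∈ DelayPDE.neighbourhood (DelayPDE.zeroSet Θl) ω,
      ∀ ψ ∈ DelayPDE.neighbourhood (DelayPDE.zeroSet Θl) ω,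
        |(η φ : ℝ) - (η ψ : ℝ)| ≤ Lη * ‖φ - ψ‖)
    (𝒜 : Set (DelayPDE.Phase r (DelayPDE.L2 Ω)))
    (h𝒜 : DelayPDE.IsGlobalAttractor (DelayPDE.evolution A d B η) 𝒜) :
    ∃ L' : ℝ≥0, 𝒜 ⊆ DelayPDE.lipschitzClass r (DelayPDE.L2 Ω) L' := by
  exact DelayPDE.attractor_subset_lipschitzClass hA_selfAdjoint hA_dense hA_pos hd hr.le hB hη h𝒜
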